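/- Let $\tilde M$ be a connected smooth manifold without boundary (finite dimensional, Hausdorff, second countable), and let $M\subset\tilde M$ be a Whitney subset: $M$ is closed and connected, $M$ is the closure of its interior in $\tilde M$, and there is a continuous linear operator $\mathcal E:\mathcal W(M)\to C^\infty(\tilde M,\mathbb R)$ such that $\mathcal E(F)$ has jet $F(x)$ at every $x\in M$, for every $F\in\mathcal W(M)$. Here $\mathcal W(M)$ is the space of Whitney jets of infinite order on $M$ with its natural Fréchet topology, and $C^\infty(\tilde M,\mathbb R)$ carries the topology of uniform convergence on compact sets in all derivatives separately. (The pair $\tilde M\supset M$ represents a Whitney manifold germ.) Let $\partial M$ be the topological boundary of $M$ in $\tilde M$. Let $\mathfrak X(M)=\{X|_M: X\in\mathfrak X(\tilde M)\}$ be the space of restrictions to $M$ of smooth vector fields on $\tilde M$, with the bracket $[X|_M,Y|_M]=[X,Y]|_M$ (well defined since $M$ is the closure of its interior) and with the Fréchet topology of Whitney jets along $M$, that is, the topology given by the Whitney seminorms in charts over compact subsets of $M$. Let $\mathfrak X_c(M)\subset\mathfrak X(M)$ be the Lie algebra of the fields with compact support, with the inductive limit (LF) topology over the spaces $\mathfrak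 X_K(M)$ of fields with support in $K$, where $K\subset M$ is compact. Let $$\mathfrak X_\partial(M)=\{X|_M: X\in\mathfrak X(\tilde M),\ x\in\partial M\Rightarrow \mathrm{Fl}^X_t(x)\in\partial M\text{ for all } t \text{ for which } \mathrm{Fl}^X_t(x)\text{ exists in }\tilde M\},$$ where $\mathrm{Fl}^X$ is the local flow of $X$ on $\tilde M$, and let $\mathfrak X_{c,\partial}(M)=\mathfrak X_\partial(M)\cap\mathfrak X_c(M)$. Then $\mathfrak X_\partial(M)$ is a closed linear Lie subalgebra of $\mathfrak X(M)$, and $\mathfrak X_{c,\partial}(M)$ is a closed linear Lie subalgebra of $\mathfrak X_c(M)$. -/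

import Mathlib

open scoped Manifold ContDiff Topology
open Set

noncomputable section

namespace WhitneyGerm

/-! ### Whitney fields in a Euclidean space

A field of formal derivatives `p` assigns to a point `z` and an order `k` a `k`-linear form `p z k`,
which plays the role of the collection of all `F^(α)(z)` with `|α| = k`. -/

section Euclidean

variable {E F : Type*} [NormedAddCommGroup E] [NormedSpace ℝ E]
  [NormedAddCommGroup F] [NormedSpace ℝ F]

/-- The Taylor polynomial `z ↦ T_y^n(p)(z)` of order `n` at `y`. -/
def taylorPoly (p : E → FormalMultilinearSeries ℝ E F) (n : ℕ) (y z : E) : F :=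
  ∑ j ∈ Finset.range (n + 1), ((j.factorial : ℝ)⁻¹) • p y j (fun _ => z - y)

/-- The remainder of order `k` : `D^k p (x) - D^k (T_y^n p) (x)`. -/
def remainder (p : E → FormalMultilinearSeries ℝ E F) (n k : ℕ) (x y : E) : E [×k]→L[ℝ] F :=
  p x k - iteratedFDeriv ℝ k (taylorPoly p n y) x

/-- The Whitney conditions on `S` : continuity of every component, and on every compact subset of
`S` the remainders of order `k ≤ n` are `o(‖x - y‖ ^ (n - k))` uniformly as `‖x - y‖ → 0`. -/
def IsWhitneyOn (S : Set E) (p : E → FormalMultilinearSeries ℝ E F) : Prop :=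
  (∀ k, ContinuousOn (fun z => p z k) S) ∧
  ∀ K ⊆ S, IsCompact K → ∀ n k, k ≤ n → ∀ ε > 0, ∃ δ > 0, ∀ x ∈ K, ∀ y ∈ K,
    0 < ‖x - y‖ → ‖x - y‖ ≤ δ → ‖remainder p n k x y‖ ≤ ε * ‖x - y‖ ^ (n - k)

/-- The topology given by the Whitney seminorms over all compact `K ⊆ S` and all orders `n` :
uniform convergence on `K` of all components `p x k`, and uniform convergence on `K × K` of all
remainder quotients `‖x - y‖ ^ (-(n - k)) • remainder p n k x y`, `k ≤ n`. (On the diagonal these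
quotients play no role: there the remainders of the jet of a function vanish.) -/
@[reducible] def whitneyTopology (S : Set E) : TopologicalSpace (E → FormalMultilinearSeries ℝ E F) :=
  (⨅ k : ℕ, TopologicalSpace.induced
    (fun p => UniformOnFun.ofFun {K : Set E | K ⊆ S ∧ IsCompact K} (fun z => p z k))
    inferInstance) ⊓
  (⨅ n : ℕ, ⨅ k : Fin (n + 1), TopologicalSpace.induced
    (fun p => UniformOnFun.ofFun {L : Set (E × E) | ∃ K : Set E, K ⊆ S ∧ IsCompact K ∧ L = K ×ˢ K}
      (fun q => (‖q.1 - q.2‖ ^ (n - (k : ℕ)))⁻¹ • remainder p n k q.1 q.2))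
    inferInstance)

lemma contDiff_taylorPoly (p : E → FormalMultilinearSeries ℝ E F) (n : ℕ) (y : E) :
    ContDiff ℝ ∞ (taylorPoly p n y) := by
  unfold taylorPoly
  refine ContDiff.sum fun j _ => contDiff_const.smul ?_
  exact (p y j).contDiff.comp (contDiff_pi.2 fun _ => contDiff_id.sub contDiff_const)

lemma remainder_add (p q : E → FormalMultilinearSeries ℝ E F) (n k : ℕ) (x y : E) :
    remainder (p + q) n k x y = remainder p n k x y + remainder q n k x y := by
  have h : taylorPoly (p + q) n y = taylorPoly p n y + taylorPoly q n y := by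
    funext z
    simp [taylorPoly, Finset.sum_add_distrib]
  unfold remainder
  rw [h, iteratedFDeriv_add_apply
    ((contDiff_taylorPoly p n y).of_le (mod_cast le_top)).contDiffAt
    ((contDiff_taylorPoly q n y).of_le (mod_cast le_top)).contDiffAt]
  exact add_sub_add_comm _ _ _ _

lemma remainder_smul (c : ℝ) (p : E → FormalMultilinearSeries ℝ E F) (n k : ℕ) (x y : E) :
    remainder (c • p) n k x y = c • remainder p n k x y := by
  have h : taylorPoly (c • p) n y = c • taylorPoly p n y := by
    funext z
    simp [taylorPoly, Finset.smul_sum, smul_comm c]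
  unfold remainder
  rw [h, iteratedFDeriv_const_smul_apply
    ((contDiff_taylorPoly p n y).of_le (mod_cast le_top)).contDiffAt]
  rw [smul_sub]
  rfl

lemma IsWhitneyOn.add {S : Set E} {p q : E → FormalMultilinearSeries ℝ E F}
    (hp : IsWhitneyOn S p) (hq : IsWhitneyOn S q) : IsWhitneyOn S (p + q) := by
  refine ⟨fun k => (hp.1 k).add (hq.1 k), fun K hK hc n k hk ε hε => ?_⟩
  obtain ⟨d₁, hd₁, h₁⟩ := hp.2 K hK hc n k hk (ε / 2) (half_pos hε)
  obtain ⟨d₂, hd₂, h₂⟩ := hq.2 K hK hc n k hk (ε / 2) (half_pos hε)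
  refine ⟨min d₁ d₂, lt_min hd₁ hd₂, fun x hx y hy h0 h => ?_⟩
  rw [remainder_add]
  refine (norm_add_le _ _).trans ?_
  have a := h₁ x hx y hy h0 (h.trans (min_le_left _ _))
  have b := h₂ x hx y hy h0 (h.trans (min_le_right _ _))
  linarith

lemma IsWhitneyOn.smul {S : Set E} {p : E → FormalMultilinearSeries ℝ E F} (c : ℝ)
    (hp : IsWhitneyOn S p) : IsWhitneyOn S (c • p) := by
  refine ⟨fun k => (hp.1 k).const_smul c, fun K hK hc n k hk ε hε => ?_⟩
  have hpos : 0 < ‖c‖ + 1 := by positivity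
  obtain ⟨d, hd, h⟩ := hp.2 K hK hc n k hk (ε / (‖c‖ + 1)) (div_pos hε hpos)
  refine ⟨d, hd, fun x hx y hy h0 hxy => ?_⟩
  rw [remainder_smul, norm_smul]
  calc ‖c‖ * ‖remainder p n k x y‖
      ≤ (‖c‖ + 1) * (ε / (‖c‖ + 1) * ‖x - y‖ ^ (n - k)) :=
        mul_le_mul (by linarith) (h x hx y hy h0 hxy) (norm_nonneg _) hpos.le
    _ = ε * ‖x - y‖ ^ (n - k) := by field_simp

lemma isWhitneyOn_zero (S : Set E) :
    IsWhitneyOn S (0 : E → FormalMultilinearSeries ℝ E F) := by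
  refine ⟨fun k => continuousOn_const, fun K _ _ n k _ ε hε => ⟨1, one_pos, ?_⟩⟩
  intro x _ y _ _ _
  have h : remainder (0 : E → FormalMultilinearSeries ℝ E F) n k x y = 0 := by
    simpa using remainder_smul (0 : ℝ) (0 : E → FormalMultilinearSeries ℝ E F) n k x y
  rw [h, norm_zero]
  positivity

end Euclidean

/-! ### Smooth functions and Whitney jets on a manifold -/

/-- The model space. -/
abbrev Model (m : ℕ) : Type := EuclideanSpace ℝ (Fin m)

section Jets

variable (m : ℕ) (N : Type*) [TopologicalSpace N] [ChartedSpace (Model m) N]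

/-- Smooth real functions on `N`. -/
abbrev SmoothFun : Type _ := C^∞⟮𝓘(ℝ, Model m), N; 𝓘(ℝ, ℝ), ℝ⟯

/-- All charts of the smooth structure of `N`. -/
abbrev Chart : Type _ :=
  {e : OpenPartialHomeomorph N (Model m) // e ∈ IsManifold.maximalAtlas 𝓘(ℝ, Model m) ∞ N}

/-- The topology on `C^∞(N, ℝ)` of uniform convergence on compact sets (of chart domains) of all
derivatives separately. -/
@[reducible] def smoothTopology : TopologicalSpace (SmoothFun m N) :=
  ⨅ (e : Chart m N) (k : ℕ), TopologicalSpace.induced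
    (fun f => UniformOnFun.ofFun {K : Set (Model m) | K ⊆ e.1.target ∧ IsCompact K}
      (iteratedFDeriv ℝ k (fun z => f (e.1.symm z))))
    inferInstance

variable {m N}

lemma contDiffAt_comp_symm [IsManifold 𝓘(ℝ, Model m) ∞ N] (f : SmoothFun m N) (e : Chart m N)
    {z : Model m} (hz : z ∈ e.1.target) : ContDiffAt ℝ ∞ (fun z => f (e.1.symm z)) z := by
  have h := (contMDiffOn_symm_of_mem_maximalAtlas e.2).contMDiffAt (e.1.open_target.mem_nhds hz)
  exact (f.contMDiff.contMDiffAt.comp z h).contDiffAt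

/-- The `k`-th derivative at `x` of a smooth function, in the chart `e` around `x`. -/
def chartDeriv [IsManifold 𝓘(ℝ, Model m) ∞ N] (e : Chart m N) (x : N) (hx : x ∈ e.1.source)
    (k : ℕ) : SmoothFun m N →ₗ[ℝ] (Model m [×k]→L[ℝ] ℝ) where
  toFun f := iteratedFDeriv ℝ k (fun z => f (e.1.symm z)) (e.1 x)
  map_add' f g := by
    have hz := e.1.map_source hx
    exact iteratedFDeriv_add_apply
      ((contDiffAt_comp_symm f e hz).of_le (mod_cast le_top))
      ((contDiffAt_comp_symm g e hz).of_le (mod_cast le_top))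
  map_smul' c f := by
    have hz := e.1.map_source hx
    exact iteratedFDeriv_const_smul_apply
      ((contDiffAt_comp_symm f e hz).of_le (mod_cast le_top))

/-- Smooth functions that are flat at `x` : all derivatives at `x` vanish, in all charts. -/
def flatAt [IsManifold 𝓘(ℝ, Model m) ∞ N] (x : N) : Submodule ℝ (SmoothFun m N) :=
  ⨅ (e : Chart m N) (hx : x ∈ e.1.source) (k : ℕ), LinearMap.ker (chartDeriv e x hx k)

/-- The space `J^∞_x(N, ℝ)` of jets of infinite order at `x`. -/
abbrev JetSpace [IsManifold 𝓘(ℝ, Model m) ∞ N] (x : N) : Type _ := SmoothFun m N ⧸ flatAt x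

/-- The `k`-th derivative of a jet at `x`, in the chart `e` around `x`. -/
def jetCoord [IsManifold 𝓘(ℝ, Model m) ∞ N] (e : Chart m N) (x : N) (hx : x ∈ e.1.source)
    (k : ℕ) : JetSpace (m := m) x →ₗ[ℝ] (Model m [×k]→L[ℝ] ℝ) :=
  (flatAt x).liftQ (chartDeriv e x hx k)
    ((iInf_le _ e).trans ((iInf_le _ hx).trans (iInf_le _ k)))

/-- The part of `M` in the domain of the chart `e`, seen in the chart. -/
def chartImage (M : Set N) (e : Chart m N) : Set (Model m) := e.1.target ∩ e.1.symm ⁻¹' M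

open Classical in
/-- A field of jets along `M`, read in the chart `e` (and extended by zero). -/
def jetSeries [IsManifold 𝓘(ℝ, Model m) ∞ N] (M : Set N) (e : Chart m N)
    (F : ∀ x : M, JetSpace (m := m) (x : N)) : Model m → FormalMultilinearSeries ℝ (Model m) ℝ :=
  fun z k => if h : z ∈ chartImage M e then
    jetCoord e (e.1.symm z) (e.1.map_target h.1) k (F ⟨e.1.symm z, h.2⟩) else 0

lemma jetSeries_add [IsManifold 𝓘(ℝ, Model m) ∞ N] (M : Set N) (e : Chart m N)
    (F G : ∀ x : M, JetSpace (m := m) (x : N)) :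
    jetSeries M e (F + G) = jetSeries M e F + jetSeries M e G := by
  funext z k
  by_cases h : z ∈ chartImage M e
  · simp [jetSeries, h]
  · simp [jetSeries, h]

lemma jetSeries_smul [IsManifold 𝓘(ℝ, Model m) ∞ N] (M : Set N) (e : Chart m N) (c : ℝ)
    (F : ∀ x : M, JetSpace (m := m) (x : N)) :
    jetSeries M e (c • F) = c • jetSeries M e F := by
  funext z k
  by_cases h : z ∈ chartImage M e
  · simp [jetSeries, h]
  · simp [jetSeries, h]

/-- The space `𝒲(M)` of Whitney jets of infinite order on `M` : fields of jets along `M` that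
satisfy the Whitney conditions in every chart. -/
def whitneyJets [IsManifold 𝓘(ℝ, Model m) ∞ N] (M : Set N) :
    Submodule ℝ (∀ x : M, JetSpace (m := m) (x : N)) where
  carrier := {F | ∀ e : Chart m N, IsWhitneyOn (chartImage M e) (jetSeries M e F)}
  add_mem' hF hG e := by
    rw [jetSeries_add]
    exact (hF e).add (hG e)
  zero_mem' e := by
    have h : jetSeries M e (0 : ∀ x : M, JetSpace (m := m) (x : N)) = 0 := by
      simpa using jetSeries_smul M e 0 0
    rw [h]
    exact isWhitneyOn_zero _
  smul_mem' c F hF e := by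
    rw [jetSeries_smul]
    exact (hF e).smul c

/-- The natural Fréchet topology on `𝒲(M)`. -/
@[reducible] def whitneyJetTopology [IsManifold 𝓘(ℝ, Model m) ∞ N] (M : Set N) :
    TopologicalSpace (whitneyJets (m := m) M) :=
  ⨅ e : Chart m N, TopologicalSpace.induced
    (fun F : whitneyJets (m := m) M => jetSeries M e F) (whitneyTopology (chartImage M e))

end Jets

/-! ### Whitney pairs -/

/-- A Whitney subset `M` of a manifold `N` : a closed connected subset that is the closure of its
interior, with a continuous linear extension operator for Whitney jets. -/
structure WhitneyPair (m : ℕ) (N : Type*) [TopologicalSpace N] [ChartedSpace (Model m) N]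
    [IsManifold 𝓘(ℝ, Model m) ∞ N] where
  /-- the underlying subset `M` of `N` -/
  carrier : Set N
  isClosed : IsClosed carrier
  isConnected : IsConnected carrier
  closure_interior : closure (interior carrier) = carrier
  exists_extension : ∃ T : whitneyJets (m := m) carrier →ₗ[ℝ] SmoothFun m N,
    Continuous[whitneyJetTopology carrier, smoothTopology m N] T ∧
    ∀ (F : whitneyJets (m := m) carrier) (x : carrier),
      (Submodule.Quotient.mk (T F) : JetSpace (m := m) (x : N)) = F.1 x

/-! ### Smooth vector fields on a manifold -/

section Fields

variable (m : ℕ) (N : Type*) [TopologicalSpace N] [ChartedSpace (Model m) N]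
  [IsManifold 𝓘(ℝ, Model m) ∞ N]

/-- Smooth vector fields on `N`. -/
abbrev SmoothField : Type _ :=
  Cₛ^∞⟮𝓘(ℝ, Model m); Model m, (TangentSpace 𝓘(ℝ, Model m) : N → Type _)⟯

variable {m N}

lemma SmoothField.mdifferentiableAt (X : SmoothField m N) (x : N) :
    MDifferentiableAt 𝓘(ℝ, Model m) 𝓘(ℝ, Model m).tangent
      (fun y => (X y : TangentBundle 𝓘(ℝ, Model m) N)) x :=
  (X.contMDiff x).mdifferentiableAt (by simp)

lemma two_le_infty : (2 : ℕ∞ω) ≤ ∞ := ENat.LEInfty.out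

/-- The usual Lie bracket of smooth vector fields. -/
instance : Bracket (SmoothField m N) (SmoothField m N) where
  bracket X Y := ⟨VectorField.mlieBracket 𝓘(ℝ, Model m) X Y, by
    have : IsManifold 𝓘(ℝ, Model m) (((⊤ : ℕ∞) : ℕ∞ω) + 1) N := by
      simpa using (inferInstance : IsManifold 𝓘(ℝ, Model m) ∞ N)
    have := IsManifold.of_le (I := 𝓘(ℝ, Model m)) (M := N) (m := minSmoothness ℝ 2) (n := ∞)
      (by rw [minSmoothness_of_isRCLikeNormedField]; exact two_le_infty)
    exact ContDiff.mlieBracket_vectorField (m := ⊤) (n := ⊤) X.contMDiff Y.contMDiff (by simp)⟩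

lemma SmoothField.lie_apply (X Y : SmoothField m N) (x : N) :
    ⁅X, Y⁆ x = VectorField.mlieBracket 𝓘(ℝ, Model m) X Y x := rfl

instance : LieRing (SmoothField m N) where
  add_lie X Y Z := by
    have := IsManifold.of_le (I := 𝓘(ℝ, Model m)) (M := N) (m := 2) (n := ∞) two_le_infty
    ext1 x
    exact VectorField.mlieBracket_add_left (X.mdifferentiableAt x) (Y.mdifferentiableAt x)
  lie_add X Y Z := by
    have := IsManifold.of_le (I := 𝓘(ℝ, Model m)) (M := N) (m := 2) (n := ∞) two_le_infty
    ext1 x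
    exact VectorField.mlieBracket_add_right (Y.mdifferentiableAt x) (Z.mdifferentiableAt x)
  lie_self X := by
    ext1 x
    exact congrFun (VectorField.mlieBracket_self (I := 𝓘(ℝ, Model m)) (V := ⇑X)) x
  leibniz_lie X Y Z := by
    have := IsManifold.of_le (I := 𝓘(ℝ, Model m)) (M := N) (m := minSmoothness ℝ 3) (n := ∞)
      (by rw [minSmoothness_of_isRCLikeNormedField]; exact ENat.LEInfty.out)
    have h2 : minSmoothness ℝ 2 ≤ ∞ := by
      rw [minSmoothness_of_isRCLikeNormedField]
      exact two_le_infty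
    ext1 x
    exact VectorField.leibniz_identity_mlieBracket_apply
      ((X.contMDiff x).of_le h2) ((Y.contMDiff x).of_le h2) ((Z.contMDiff x).of_le h2)

instance : LieAlgebra ℝ (SmoothField m N) where
  lie_smul c X Y := by
    have := IsManifold.of_le (I := 𝓘(ℝ, Model m)) (M := N) (m := 2) (n := ∞) two_le_infty
    ext1 x
    exact VectorField.mlieBracket_const_smul_right (Y.mdifferentiableAt x)

/-- A smooth vector field, read in the chart `e`. -/
def chartField (e : Chart m N) (X : SmoothField m N) (z : Model m) : Model m :=
  mfderiv 𝓘(ℝ, Model m) 𝓘(ℝ, Model m) e.1 (e.1.symm z) (X (e.1.symm z))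

/-- All derivatives of a smooth vector field in the chart `e`. -/
def chartFieldSeries (e : Chart m N) (X : SmoothField m N) :
    Model m → FormalMultilinearSeries ℝ (Model m) (Model m) :=
  fun z k => iteratedFDeriv ℝ k (chartField e X) z

lemma contDiffAt_chartField (e : Chart m N) (X : SmoothField m N) {z : Model m}
    (hz : z ∈ e.1.target) : ContDiffAt ℝ ∞ (chartField e X) z := by
  have hx : e.1.symm z ∈ e.1.source := e.1.map_target hz
  have h1 : ContMDiffAt 𝓘(ℝ, Model m) 𝓘(ℝ, Model m) ∞ e.1.symm z :=
    (contMDiffOn_symm_of_mem_maximalAtlas e.2).contMDiffAt (e.1.open_target.mem_nhds hz)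
  have h2 := (contMDiffOn_of_mem_maximalAtlas e.2).contMDiffOn_tangentMapWithin (m := ∞)
    (by simp) e.1.open_source.uniqueMDiffOn
  have hp : ⟨e.1.symm z, X (e.1.symm z)⟩ ∈
      (Bundle.TotalSpace.proj ⁻¹' e.1.source : Set (TangentBundle 𝓘(ℝ, Model m) N)) := hx
  have ho : IsOpen (Bundle.TotalSpace.proj ⁻¹' e.1.source :
      Set (TangentBundle 𝓘(ℝ, Model m) N)) :=
    e.1.open_source.preimage (FiberBundle.continuous_proj (Model m) _)
  have h3 := h2.contMDiffAt (ho.mem_nhds hp)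
  have h4 := (contMDiff_snd_tangentBundle_modelSpace (n := ∞) (Model m)
    𝓘(ℝ, Model m)).contMDiffAt.comp _ (h3.comp z ((X.contMDiff (e.1.symm z)).comp z h1))
  refine h4.contDiffAt.congr_of_eventuallyEq ?_
  filter_upwards [e.1.open_target.mem_nhds hz] with w hw
  simp only [chartField, tangentMapWithin, Function.comp]
  rw [mfderivWithin_of_isOpen e.1.open_source (e.1.map_target hw)]

/-- The derivatives of a smooth field at the points of `M` depend only on its restriction to `M`,
if `M` is the closure of its interior. -/
lemma chartFieldSeries_congr {M : Set N} (hM : closure (interior M) = M) {X Y : SmoothField m N}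
    (h : ∀ x ∈ M, X x = Y x) (e : Chart m N) {z : Model m} (hz : z ∈ chartImage M e) :
    chartFieldSeries e X z = chartFieldSeries e Y z := by
  funext k
  have hc (Z : SmoothField m N) :
      ContinuousOn (iteratedFDeriv ℝ k (chartField e Z)) e.1.target := by
    intro w hw
    exact ((contDiffAt_chartField e Z hw).continuousAt_iteratedFDeriv
      (mod_cast le_top)).continuousWithinAt
  have hU : IsOpen (e.1.target ∩ e.1.symm ⁻¹' interior M) :=
    e.1.isOpen_inter_preimage_symm isOpen_interior
  have hEq : EqOn (iteratedFDeriv ℝ k (chartField e X)) (iteratedFDeriv ℝ k (chartField e Y))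
      (e.1.target ∩ e.1.symm ⁻¹' interior M) := by
    intro w hw
    refine (Filter.EventuallyEq.iteratedFDeriv ℝ ?_ k).eq_of_nhds
    filter_upwards [hU.mem_nhds hw] with v hv
    simp only [chartField]
    rw [h _ (interior_subset hv.2)]
  have hcl : z ∈ closure (e.1.target ∩ e.1.symm ⁻¹' interior M) := by
    have hx : e.1.symm z ∈ closure (interior M) := by rw [hM]; exact hz.2
    rw [mem_closure_iff_nhds] at hx ⊢
    intro V hV
    obtain ⟨y, hy, hyM⟩ := hx (e.1.source ∩ e.1 ⁻¹' V) (Filter.inter_mem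
      (e.1.open_source.mem_nhds (e.1.map_target hz.1))
      ((e.1.continuousAt (e.1.map_target hz.1)).preimage_mem_nhds
        (by rw [e.1.right_inv hz.1]; exact hV)))
    exact ⟨e.1 y, hy.2, e.1.map_source hy.1, by simpa [e.1.left_inv hy.1] using hyM⟩
  exact hEq.of_subset_closure (hc X |>.mono inter_subset_left) (hc Y |>.mono inter_subset_left)
    (t := e.1.target ∩ closure (e.1.target ∩ e.1.symm ⁻¹' interior M))
    (fun w hw => ⟨hw.1, subset_closure hw⟩) inter_subset_right ⟨hz.1, hcl⟩

/-- The flow of `X` preserves the set `B` : for `x ∈ B` we have `Fl_t^X(x) ∈ B` for all `t` for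
which `Fl_t^X(x)` exists, i.e. the integral curve of `X` through `x`, on any open
interval around `0` on which it exists, stays in `B`. -/
def FlowPreserves (X : SmoothField m N) (B : Set N) : Prop :=
  ∀ x ∈ B, ∀ (γ : ℝ → N) (a b : ℝ), a < 0 → 0 < b → γ 0 = x →
    IsMIntegralCurveOn (I := 𝓘(ℝ, Model m)) γ X (Ioo a b) → ∀ t ∈ Ioo a b, γ t ∈ B

/-- Restriction of vector fields on `N` to sections over `M` of the tangent bundle of `N`. -/
def restrictField (M : Set N) :
    SmoothField m N →ₗ[ℝ] (∀ x : M, TangentSpace 𝓘(ℝ, Model m) (x : N)) where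
  toFun X := fun x => X x
  map_add' _ _ := rfl
  map_smul' _ _ := rfl

lemma isClosed_zeros (X : SmoothField m N) : IsClosed {x : N | X x = 0} := by
  rw [← isOpen_compl_iff, isOpen_iff_mem_nhds]
  intro x hx
  have hx : X x ≠ 0 := hx
  let t := trivializationAt (Model m) (TangentSpace 𝓘(ℝ, Model m) : N → Type _) x
  have hb : x ∈ t.baseSet := FiberBundle.mem_baseSet_trivializationAt' x
  have hc := ((Bundle.contMDiffAt_section (F := Model m)
    (E := (TangentSpace 𝓘(ℝ, Model m) : N → Type _)) (s := X) x).1 (X.contMDiff x)).continuousAt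
  have h0 : (t ⟨x, X x⟩).2 ≠ 0 := by
    intro h
    apply hx
    have := (t.linearEquivAt ℝ x hb).map_eq_zero_iff (x := X x)
    exact this.1 h
  filter_upwards [hc.eventually_ne h0, t.open_baseSet.mem_nhds hb] with y hy hyb h
  apply hy
  have h : X y = 0 := h
  have := (t.linearEquivAt ℝ y hyb).map_zero
  rw [← h] at this
  exact this

/-- The bracket is local on a set which is the closure of its interior. -/
lemma lie_eq_zero_of_eq_zero {M O : Set N} (hM : closure (interior M) = M) (hO : IsOpen O)
    (X Y : SmoothField m N) (h : ∀ x ∈ M ∩ O, X x = 0) : ∀ x ∈ M ∩ O, ⁅X, Y⁆ x = 0 := by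
  intro x hx
  have key : interior M ∩ O ⊆ {x : N | ⁅X, Y⁆ x = 0} := by
    intro y hy
    have he : (X : ∀ x : N, TangentSpace 𝓘(ℝ, Model m) x) =ᶠ[𝓝 y] 0 := by
      filter_upwards [(isOpen_interior.inter hO).mem_nhds hy] with z hz
      exact h z ⟨interior_subset hz.1, hz.2⟩
    have h2 := he.mlieBracket_vectorField_eq
      (Filter.EventuallyEq.refl (𝓝 y) (Y : ∀ x : N, TangentSpace 𝓘(ℝ, Model m) x))
    change VectorField.mlieBracket 𝓘(ℝ, Model m) X Y y = 0
    rw [h2]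
    exact congrFun VectorField.mlieBracket_zero_left y
  have hxc : x ∈ closure (interior M ∩ O) := by
    rw [inter_comm]
    exact hO.inter_closure ⟨hx.2, by rw [hM]; exact hx.1⟩
  exact (isClosed_zeros ⁅X, Y⁆).closure_subset_iff.2 key hxc

end Fields

/-! ### Vector fields on a Whitney pair -/

namespace WhitneyPair

variable {m : ℕ} {N : Type*} [TopologicalSpace N] [ChartedSpace (Model m) N]
  [IsManifold 𝓘(ℝ, Model m) ∞ N] (M : WhitneyPair m N)

/-- The space `𝔛(M)` of restrictions to `M` of smooth vector fields on `N`. -/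
def fields : Submodule ℝ (∀ x : M.carrier, TangentSpace 𝓘(ℝ, Model m) (x : N)) :=
  LinearMap.range (restrictField M.carrier)

/-- The restriction `X ↦ X|_M`. -/
def restrict : SmoothField m N →ₗ[ℝ] M.fields := (restrictField M.carrier).rangeRestrict

variable {M} in
/-- Some smooth extension to `N` of a vector field on `M`. -/
def extend (X : M.fields) : SmoothField m N := X.2.choose

variable {M} in
@[simp] lemma restrict_extend (X : M.fields) : M.restrict (extend X) = X :=
  Subtype.ext X.2.choose_spec

lemma restrict_eq_zero_iff (X : SmoothField m N) :
    M.restrict X = 0 ↔ ∀ x ∈ M.carrier, X x = 0 := by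
  constructor
  · intro h x hx
    exact congrFun (congrArg Subtype.val h) ⟨x, hx⟩
  · intro h
    exact Subtype.ext (funext fun x => h x x.2)

lemma restrict_lie_congr {X X' Y Y' : SmoothField m N} (hX : M.restrict X = M.restrict X')
    (hY : M.restrict Y = M.restrict Y') : M.restrict ⁅X, Y⁆ = M.restrict ⁅X', Y'⁆ := by
  have h (U V : SmoothField m N) (hU : M.restrict U = 0) : M.restrict ⁅U, V⁆ = 0 := by
    rw [restrict_eq_zero_iff] at hU ⊢
    intro x hx
    exact lie_eq_zero_of_eq_zero M.closure_interior isOpen_univ U V (fun y hy => hU y hy.1) x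
      ⟨hx, mem_univ x⟩
  have h1 := h (X - X') Y (by rw [map_sub, hX, sub_self])
  have h2 := h (Y - Y') X' (by rw [map_sub, hY, sub_self])
  rw [sub_lie, map_sub, sub_eq_zero] at h1
  rw [sub_lie, map_sub, sub_eq_zero] at h2
  rw [h1, ← lie_skew, ← lie_skew X', map_neg, map_neg, h2]

/-- The bracket of `𝔛(M)` : the restriction of the bracket of smooth extensions. -/
instance : Bracket M.fields M.fields where
  bracket X Y := M.restrict ⁅extend X, extend Y⁆

/-- The bracket on `𝔛(M)` does not depend on the chosen extensions. -/
lemma restrict_lie (X Y : SmoothField m N) :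
    M.restrict ⁅X, Y⁆ = ⁅M.restrict X, M.restrict Y⁆ :=
  M.restrict_lie_congr (restrict_extend _).symm (restrict_extend _).symm

lemma restrict_surjective : Function.Surjective M.restrict := fun X => ⟨_, restrict_extend X⟩

instance : LieRing M.fields where
  add_lie X Y Z := by
    obtain ⟨X, rfl⟩ := M.restrict_surjective X
    obtain ⟨Y, rfl⟩ := M.restrict_surjective Y
    obtain ⟨Z, rfl⟩ := M.restrict_surjective Z
    simp only [← map_add, ← restrict_lie, add_lie]
  lie_add X Y Z := by
    obtain ⟨X, rfl⟩ := M.restrict_surjective X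
    obtain ⟨Y, rfl⟩ := M.restrict_surjective Y
    obtain ⟨Z, rfl⟩ := M.restrict_surjective Z
    simp only [← map_add, ← restrict_lie, lie_add]
  lie_self X := by
    obtain ⟨X, rfl⟩ := M.restrict_surjective X
    rw [← restrict_lie, lie_self, map_zero]
  leibniz_lie X Y Z := by
    obtain ⟨X, rfl⟩ := M.restrict_surjective X
    obtain ⟨Y, rfl⟩ := M.restrict_surjective Y
    obtain ⟨Z, rfl⟩ := M.restrict_surjective Z
    simp only [← restrict_lie, ← map_add]
    rw [← leibniz_lie]

instance : LieAlgebra ℝ M.fields where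
  lie_smul c X Y := by
    obtain ⟨X, rfl⟩ := M.restrict_surjective X
    obtain ⟨Y, rfl⟩ := M.restrict_surjective Y
    simp only [← map_smul, ← restrict_lie, lie_smul]

/-- The Fréchet topology on `𝔛(M)` : the topology of the Whitney jets along `M`, given in the
charts by the derivatives at the points of `M` of a smooth extension. As `M` is the closure of its
interior, these derivatives do not depend on the extension. -/
@[reducible] def fieldTopology : TopologicalSpace M.fields :=
  ⨅ e : Chart m N, TopologicalSpace.induced (fun X : M.fields => chartFieldSeries e (extend X))
    (whitneyTopology (chartImage M.carrier e))

/-- The support of a vector field on `M`. -/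
def supp (X : M.fields) : Set N := closure {x : N | ∃ h : x ∈ M.carrier, X.1 ⟨x, h⟩ ≠ 0}

lemma supp_subset_iff (X : M.fields) {C : Set N} (hC : IsClosed C) :
    M.supp X ⊆ C ↔ ∀ x (h : x ∈ M.carrier), x ∉ C → X.1 ⟨x, h⟩ = 0 := by
  unfold supp
  rw [hC.closure_subset_iff]
  constructor
  · intro h x hx hxC
    by_contra h0
    exact hxC (h ⟨hx, h0⟩)
  · rintro h x ⟨hx, h0⟩
    by_contra hxC
    exact h0 (h x hx hxC)

lemma eq_zero_of_notMem_supp (X : M.fields) {x : N} (hx : x ∈ M.carrier) (h : x ∉ M.supp X) :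
    X.1 ⟨x, hx⟩ = 0 :=
  (M.supp_subset_iff X isClosed_closure).1 subset_rfl x hx h

/-- The Lie algebra `𝔛_c(M)` of vector fields on `M` with compact support. -/
def compactFields : LieSubalgebra ℝ M.fields where
  carrier := {X | IsCompact (M.supp X)}
  add_mem' {X Y} hX hY := by
    have hC : IsClosed (M.supp X ∪ M.supp Y) := isClosed_closure.union isClosed_closure
    refine (hX.union hY).of_isClosed_subset isClosed_closure
      ((M.supp_subset_iff _ hC).2 fun x hx h => ?_)
    rw [mem_union, not_or] at h
    change X.1 ⟨x, hx⟩ + Y.1 ⟨x, hx⟩ = 0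
    rw [M.eq_zero_of_notMem_supp X hx h.1, M.eq_zero_of_notMem_supp Y hx h.2, add_zero]
  zero_mem' := by
    have h : M.supp 0 ⊆ ∅ := (M.supp_subset_iff 0 isClosed_empty).2 fun x hx _ => rfl
    change IsCompact (M.supp 0)
    rw [subset_empty_iff.1 h]
    exact isCompact_empty
  smul_mem' c X hX := by
    refine hX.of_isClosed_subset isClosed_closure
      ((M.supp_subset_iff _ isClosed_closure).2 fun x hx h => ?_)
    change c • X.1 ⟨x, hx⟩ = 0
    rw [M.eq_zero_of_notMem_supp X hx h, smul_zero]
  lie_mem' {X Y} hX _ := by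
    refine hX.of_isClosed_subset isClosed_closure
      ((M.supp_subset_iff _ isClosed_closure).2 fun x hx h => ?_)
    refine lie_eq_zero_of_eq_zero M.closure_interior (O := (M.supp X)ᶜ)
      isClosed_closure.isOpen_compl (extend X) (extend Y) (fun y hy => ?_) x ⟨hx, h⟩
    have h1 : (extend X) y = X.1 ⟨y, hy.1⟩ :=
      congrFun (congrArg Subtype.val (restrict_extend X)) ⟨y, hy.1⟩
    rw [h1]
    exact M.eq_zero_of_notMem_supp X hy.1 hy.2

/-- The inductive limit (LF) topology on `𝔛_c(M)` : the finest locally convex vector space topology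
for which, for every compact `K ⊆ M`, the inclusion of the space `𝔛_K(M)` of fields with
support in `K` (with the topology induced from `𝔛(M)`) is continuous. -/
@[reducible] def compactFieldTopology : TopologicalSpace M.compactFields :=
  sInf {t | @IsTopologicalAddGroup M.compactFields t _ ∧
    @ContinuousSMul ℝ M.compactFields _ _ t ∧
    @LocallyConvexSpace ℝ M.compactFields _ _ _ _ t ∧
    ∀ K : Set N, K ⊆ M.carrier → IsCompact K →
      Continuous[TopologicalSpace.induced
          (fun X : {X : M.compactFields // M.supp X.1 ⊆ K} => X.1.1) M.fieldTopology, t]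
        (fun X : {X : M.compactFields // M.supp X.1 ⊆ K} => X.1)}

/-- The boundary of `M` : its topological boundary in `N`. -/
def boundary : Set N := frontier M.carrier

/-- The space `𝔛_∂(M)` of the restrictions to `M` of the smooth vector fields on `N` whose
flow preserves the boundary of `M`. -/
def boundaryFields : Set M.fields :=
  {Y | ∃ X : SmoothField m N, M.restrict X = Y ∧ FlowPreserves X M.boundary}

/-- The space `𝔛_{c,∂}(M)` of the fields in `𝔛_∂(M)` with compact support. -/
def compactBoundaryFields : Set M.compactFields := {Y | (Y : M.fields) ∈ M.boundaryFields}

end WhitneyPair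

end WhitneyGerm

end

open scoped Manifold ContDiff Topology
open Set

noncomputable section

namespace WhitneyGerm

/-! ### Invariant sets of ordinary differential equations -/

section Invariance

open Filter Asymptotics Metric

variable {E : Type*} [NormedAddCommGroup E] [NormedSpace ℝ E]

/-! Flow invariance of a closed set `B` is equivalent to a pointwise tangency condition. If `X p`
and `-X p` are tangent to `B` at every `p ∈ B`, meaning that in charts the distance of `p + h • v`
from `B` is `o(h)` as `h → 0+`, then Nagumo's theorem (`eventually_mem_of_isTangentDirection`) keeps
integral curves in `B`, forwards and, after time reversal, backwards. Conversely, an invariant flow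
moves `p` inside `B` with velocity `±X p`.

Closedness follows at once. The condition involves only values at points of `∂M ⊆ M`, so it does not
depend on the extension (`mem_boundaryFields_iff`). The tangent directions at a point form a closed
set, and evaluation at a point is continuous for the Fréchet topology and for the LF topology. Both
spaces are therefore intersections of closed preimages.

The algebra structure is not pointwise linear algebra, since the tangent directions of an arbitrary
closed set need not be convex. Instead the flows are composed: a flow leaving `B` invariant carries
a curve `z + t • a + t ^ 2 • b + o(t ^ 2)` in `B` to another such curve, with explicit coefficients
(`HasPath.flow`). Two flows in succession give tangency of sums. The commutator of two flows has
vanishing first order term and the Lie bracket at second order, so replacing `t` by `√t` gives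
tangency of the bracket. Nagumo's theorem then turns tangency back into invariance. -/

/-- `v` is a tangent direction of `S` at `p` : the distance of `p + h • v` from `S` is `o(h)` as
`h → 0+`. -/
def IsTangentDirection (S : Set E) (p v : E) : Prop :=
  ∀ ε > 0, ∀ᶠ h : ℝ in 𝓝[>] 0, ∃ q ∈ S, ‖q - (p + h • v)‖ ≤ ε * h

/-- Replacing `v` by a nearby `w` moves `p + h • v` by only `h * ‖w - v‖`, which the tolerance `ε *
h` absorbs. -/
lemma isClosed_setOf_isTangentDirection (S : Set E) (p : E) :
    IsClosed {v | IsTangentDirection S p v} := by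
  refine isClosed_of_closure_subset fun v hv ε hε => ?_
  obtain ⟨w, hw, hvw⟩ := Metric.mem_closure_iff.1 hv (ε / 2) (half_pos hε)
  filter_upwards [hw (ε / 2) (half_pos hε), self_mem_nhdsWithin] with h ⟨q, hq, hqw⟩ (h0 : 0 < h)
  refine ⟨q, hq, ?_⟩
  have e : q - (p + h • v) = (q - (p + h • w)) + h • (w - v) := by module
  rw [dist_eq_norm, norm_sub_rev] at hvw
  calc ‖q - (p + h • v)‖ ≤ ‖q - (p + h • w)‖ + ‖h • (w - v)‖ := by rw [e]; exact norm_add_le _ _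
    _ ≤ ε / 2 * h + h * (ε / 2) := by
        rw [norm_smul, Real.norm_of_nonneg h0.le]
        gcongr
    _ = ε * h := by ring

/-- Nagumo's invariance theorem, in local form: if a Lipschitz vector field is tangent to a locally
closed set, then its integral curves starting in the set stay there for a short time. -/
theorem eventually_mem_of_isTangentDirection [ProperSpace E] {S : Set E} {z : E} {r : ℝ}
    (hr : 0 < r) (hz : z ∈ S) (hS : IsClosed (S ∩ closedBall z r)) {f : E → E} {K : NNReal}
    (hf : LipschitzOnWith K f (closedBall z r))
    (htan : ∀ p ∈ S ∩ ball z r, IsTangentDirection S p (f p)) {α : ℝ → E} {t₀ : ℝ}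
    (h0 : α t₀ = z) (hα : ∀ᶠ t in 𝓝 t₀, HasDerivAt α (f (α t)) t) :
    ∀ᶠ t in 𝓝[>] t₀, α t ∈ S := by
  set C := S ∩ closedBall z r with hC
  have hzC : z ∈ C := ⟨hz, mem_closedBall_self hr.le⟩
  have hCc : IsCompact C := (isCompact_closedBall z r).of_isClosed_subset hS inter_subset_right
  have hnear : ∀ᶠ t in 𝓝 t₀, α t ∈ ball z (r / 2) :=
    hα.self_of_nhds.continuousAt.eventually (by rw [h0]; exact ball_mem_nhds z (half_pos hr))
  obtain ⟨δ, hδ, H⟩ := Metric.eventually_nhds_iff.1 (hα.and hnear)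
  have H' : ∀ t ∈ Icc t₀ (t₀ + δ / 2), HasDerivAt α (f (α t)) t ∧ α t ∈ ball z (r / 2) := by
    intro t ht
    refine H ?_
    rw [Real.dist_eq, abs_of_nonneg (by linarith [ht.1])]
    linarith [ht.2]
  -- The distance `d` from `α t` to `C` vanishes at `t₀` and has lower right derivative at most `K *
  -- d`, so Grönwall forces `d = 0`.
  have key := le_gronwallBound_of_liminf_deriv_right_le (f := fun t => infDist (α t) C)
    (f' := fun t => K * infDist (α t) C) (δ := 0) (K := K) (ε := 0) (a := t₀) (b := t₀ + δ / 2)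
    (fun t ht => ((continuous_infDist_pt C).continuousAt.comp
      (H' t ht).1.continuousAt).continuousWithinAt) ?_
    (by rw [h0, infDist_zero_of_mem hzC]) (fun t _ => by simp)
  · filter_upwards [Ioo_mem_nhdsGT (show t₀ < t₀ + δ / 2 by linarith)] with t ht
    have h1 := key t ⟨ht.1.le, ht.2.le⟩
    rw [gronwallBound_ε0_δ0] at h1
    exact ((hS.mem_iff_infDist_zero ⟨z, hzC⟩).2 (le_antisymm h1 infDist_nonneg)).1
  intro t ht ρ hρ
  refine Eventually.frequently ?_
  obtain ⟨hd, hb⟩ := H' t ⟨ht.1, ht.2.le⟩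
  obtain ⟨p, hpC, hp⟩ := hCc.exists_infDist_eq_dist ⟨z, hzC⟩ (α t)
  have hpz : dist p z < r := by
    have h1 : dist (α t) p ≤ dist (α t) z := hp ▸ infDist_le_dist_of_mem hzC
    have h2 := dist_triangle_left p z (α t)
    rw [mem_ball] at hb
    linarith
  -- Two errors of size `ε * h` will occur, one from differentiating `α` and one from the tangency
  -- at `p`; a third of the gap leaves strict room below `ρ`.
  set ε := (ρ - K * infDist (α t) C) / 3 with hε
  have hε0 : 0 < ε := by
    have : K * infDist (α t) C < ρ := hρ
    simp only [hε]; linarith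
  have hshift : Tendsto (fun s : ℝ => s - t) (𝓝[>] t) (𝓝[>] 0) := by
    refine tendsto_nhdsWithin_iff.2 ⟨?_, ?_⟩
    · exact ((continuous_id.sub continuous_const).tendsto' t 0 (sub_self t)).mono_left
        nhdsWithin_le_nhds
    · filter_upwards [self_mem_nhdsWithin] with s hs using sub_pos.2 (mem_Ioi.1 hs)
  -- Tangency only supplies `q ∈ S`; this bound keeps `q` in the closed ball, hence in `C`.
  have hsmall : ∀ᶠ h : ℝ in 𝓝[>] 0, ‖h • f p‖ + ε * h < r - dist p z := by
    have hc : Continuous fun h : ℝ => ‖h • f p‖ + ε * h := by fun_prop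
    exact ((hc.tendsto' 0 0 (by simp)).mono_left nhdsWithin_le_nhds).eventually_lt_const
      (sub_pos.2 hpz)
  have hderiv := (hasDerivAt_iff_isLittleO.1 hd).def hε0
  filter_upwards [hshift.eventually (htan p ⟨hpC.1, hpz⟩ ε hε0), hshift.eventually hsmall,
    hderiv.filter_mono nhdsWithin_le_nhds, self_mem_nhdsWithin] with s ⟨q, hq, hqp⟩ hs hs' (hts : t < s)
  have hpos : 0 < s - t := sub_pos.2 hts
  rw [Real.norm_of_nonneg hpos.le] at hs'
  have hqC : q ∈ C := by
    refine ⟨hq, ?_⟩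
    rw [mem_closedBall, dist_eq_norm]
    have e : q - z = (q - (p + (s - t) • f p)) + (s - t) • f p + (p - z) := by abel
    rw [e]
    refine (norm_add₃_le).trans ?_
    rw [dist_eq_norm] at hs
    linarith
  have hL : ‖f (α t) - f p‖ ≤ K * dist (α t) p := by
    rw [← dist_eq_norm]
    exact hf.dist_le_mul _ (ball_subset_closedBall (ball_subset_ball (by linarith) hb)) _ hpC.2
  have hfin : infDist (α s) C ≤ infDist (α t) C + (s - t) * (K * infDist (α t) C + 2 * ε) := by
    refine (infDist_le_dist_of_mem hqC).trans ?_
    rw [dist_eq_norm]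
    -- Compare the curve at `α t` with the tangent step at its nearest point `p`: the old distance,
    -- the Lipschitz difference of the velocities, and the two small errors.
    have e : α s - q = (α s - α t - (s - t) • f (α t)) + (α t - p) + (s - t) • (f (α t) - f p)
        - (q - (p + (s - t) • f p)) := by module
    rw [e]
    refine (norm_sub_le _ _).trans ((add_le_add_left norm_add₃_le _).trans ?_)
    rw [norm_smul, Real.norm_of_nonneg hpos.le, ← dist_eq_norm (α t) p, hp]
    have := mul_le_mul_of_nonneg_left hL hpos.le
    linarith
  rw [inv_mul_lt_iff₀ hpos]
  have : K * infDist (α t) C + 2 * ε < ρ := by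
    have : K * infDist (α t) C < ρ := hρ
    simp only [hε]; linarith
  have := mul_lt_mul_of_pos_left this hpos
  linarith

/-! ### Local flows and their second order expansion -/

/-- A local flow of `f` around `z`, given on `ball z ρ × (-ρ, ρ)`. -/
structure IsLocalFlow (f : E → E) (z : E) (ρ : ℝ) (Φ : E × ℝ → E) : Prop where
  pos : 0 < ρ
  tendsto : Tendsto Φ (𝓝 (z, 0)) (𝓝 z)
  map_zero : ∀ x ∈ ball z ρ, Φ (x, 0) = x
  hasDerivAt : ∀ x ∈ ball z ρ, ∀ t ∈ Ioo (-ρ) ρ, HasDerivAt (fun s => Φ (x, s)) (f (Φ (x, t))) t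

lemma IsLocalFlow.mono {f : E → E} {z : E} {ρ ρ' : ℝ} {Φ : E × ℝ → E} (h : IsLocalFlow f z ρ Φ)
    (h0 : 0 < ρ') (hρ : ρ' ≤ ρ) : IsLocalFlow f z ρ' Φ where
  pos := h0
  tendsto := h.tendsto
  map_zero x hx := h.map_zero x (ball_subset_ball hρ hx)
  hasDerivAt x hx t ht := h.hasDerivAt x (ball_subset_ball hρ hx) t
    (Ioo_subset_Ioo (neg_le_neg hρ) hρ ht)

/-- Picard–Lindelöf with a common time interval for nearby initial points; joint continuity of the
solution gives the limit at `(z, 0)`. -/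
lemma exists_isLocalFlow [CompleteSpace E] {f : E → E} {z : E} (hf : ContDiffAt ℝ 1 f z) :
    ∃ ρ Φ, IsLocalFlow f z ρ Φ := by
  obtain ⟨ε, hε, a, r, L, K, hr, h⟩ := IsPicardLindelof.of_contDiffAt_one hf
  obtain ⟨Φ, h1, h2⟩ := (h 0).exists_forall_mem_closedBall_eq_hasDerivWithinAt_continuousOn
  have hr' : (0 : ℝ) < r := hr
  rw [zero_sub, zero_add] at h2
  simp only [zero_sub, zero_add] at h1
  have hball : ball z (min ε r) ⊆ closedBall z r :=
    ball_subset_closedBall.trans (closedBall_subset_closedBall (min_le_right _ _))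
  refine ⟨min ε r, Φ, lt_min hε hr', ?_, fun x hx => (h1 x (hball hx)).1, fun x hx t ht => ?_⟩
  · have hc : ContinuousAt Φ (z, 0) := h2.continuousAt (prod_mem_nhds (closedBall_mem_nhds z hr')
      (Icc_mem_nhds (by linarith) hε))
    have h0 := (h1 z (mem_closedBall_self hr'.le)).1
    have hc' : Tendsto Φ (𝓝 (z, 0)) (𝓝 (Φ (z, 0))) := hc
    rwa [h0] at hc'
  · have ht' : t ∈ Ioo (-ε) ε :=
      ⟨(neg_le_neg (min_le_left _ _)).trans_lt ht.1, ht.2.trans_le (min_le_left _ _)⟩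
    exact ((h1 x (hball hx)).2 t (Ioo_subset_Icc_self ht')).hasDerivAt (Icc_mem_nhds ht'.1 ht'.2)

/-- The Taylor expansion of second order of a local flow, uniform in the initial point. -/
lemma IsLocalFlow.isLittleO {f : E → E} {z : E} {ρ : ℝ} {Φ : E × ℝ → E}
    (h : IsLocalFlow f z ρ Φ) (hf : ContDiffAt ℝ 1 f z) :
    (fun q : E × ℝ => Φ q - (q.1 + q.2 • f q.1 + (q.2 ^ 2 / 2) • fderiv ℝ f z (f z)))
      =o[𝓝 (z, 0)] fun q => q.2 ^ 2 := by
  set g := fderiv ℝ f z (f z) with hg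
  rw [isLittleO_iff]
  intro ε hε
  have hcont : ContinuousAt (fun w => fderiv ℝ f w (f w)) z :=
    ((hf.fderiv_right (m := 0) le_rfl).continuousAt).clm_apply hf.continuousAt
  have hdiff : ∀ᶠ w in 𝓝 z, DifferentiableAt ℝ f w := by
    filter_upwards [hf.eventually (by simp)] with w hw using hw.differentiableAt one_ne_zero
  have hclose : ∀ᶠ w in 𝓝 z, ‖fderiv ℝ f w (f w) - g‖ ≤ ε := by
    filter_upwards [hcont.eventually (closedBall_mem_nhds _ hε)] with w hw
    rwa [← dist_eq_norm]
  obtain ⟨δ, hδ, H⟩ := Metric.eventually_nhds_iff.1 (h.tendsto.eventually (hdiff.and hclose))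
  filter_upwards [ball_mem_nhds (z, (0 : ℝ)) (lt_min hδ h.pos)] with ⟨x, t⟩ hxt
  rw [← ball_prod_same, mem_prod, mem_ball, mem_ball, Real.dist_eq, sub_zero] at hxt
  obtain ⟨hx, ht⟩ := hxt
  have hxρ : x ∈ ball z ρ := hx.trans_le (min_le_right _ _)
  have hmem : ∀ s ∈ uIcc 0 t, |s| ≤ |t| := by
    intro s hs
    have := abs_sub_left_of_mem_uIcc hs
    simpa using this
  have hD : ∀ s ∈ uIcc 0 t, HasDerivAt (fun s => Φ (x, s)) (f (Φ (x, s))) s := fun s hs =>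
    h.hasDerivAt x hxρ s (abs_lt.1 ((hmem s hs).trans_lt (ht.trans_le (min_le_right _ _))))
  have hH : ∀ s ∈ uIcc 0 t, DifferentiableAt ℝ f (Φ (x, s)) ∧
      ‖fderiv ℝ f (Φ (x, s)) (f (Φ (x, s))) - g‖ ≤ ε := by
    intro s hs
    refine H ?_
    rw [Prod.dist_eq, Real.dist_eq, sub_zero]
    exact max_lt (hx.trans_le (min_le_left _ _))
      ((hmem s hs).trans_lt (ht.trans_le (min_le_left _ _)))
  have hconv : Convex ℝ (uIcc 0 t) := convex_uIcc 0 t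
  -- The derivative of `f` along the orbit stays within `ε` of `g`. The mean value inequality, here
  -- for the velocity and below for the position, gives an error `ε * t ^ 2`; only `C¹` regularity
  -- of `f` is needed.
  have hA : ∀ s ∈ uIcc 0 t, ‖f (Φ (x, s)) - f x - s • g‖ ≤ ε * |t| := by
    intro s hs
    have := hconv.norm_image_sub_le_of_norm_hasDerivWithin_le
      (f := fun s => f (Φ (x, s)) - f x - s • g)
      (f' := fun s => fderiv ℝ f (Φ (x, s)) (f (Φ (x, s))) - (1 : ℝ) • g) (C := ε) (x := 0) (y := s)
      (fun u hu => ((((hH u hu).1.hasFDerivAt.comp_hasDerivAt u (hD u hu)).sub_const _).sub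
        ((hasDerivAt_id u).smul_const g)).hasDerivWithinAt)
      (fun u hu => by rw [one_smul]; exact (hH u hu).2) left_mem_uIcc hs
    simp only [h.map_zero x hxρ, sub_self, zero_smul, sub_zero, Real.norm_eq_abs] at this
    exact this.trans (mul_le_mul_of_nonneg_left (hmem s hs) hε.le)
  have := hconv.norm_image_sub_le_of_norm_hasDerivWithin_le
      (f := fun s => Φ (x, s) - (x + s • f x + (s ^ 2 / 2) • g))
      (f' := fun s => f (Φ (x, s)) - ((1 : ℝ) • f x + ((2 : ℕ) * s ^ (2 - 1) / 2) • g))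
      (C := ε * |t|) (x := 0) (y := t)
      (fun u hu => ((hD u hu).sub ((((hasDerivAt_id u).smul_const (f x)).const_add x).add
        (((hasDerivAt_pow 2 u).div_const 2).smul_const g))).hasDerivWithinAt)
      (fun u hu => by
        have e : f (Φ (x, u)) - ((1 : ℝ) • f x + (((2 : ℕ) : ℝ) * u ^ (2 - 1) / 2) • g) =
            f (Φ (x, u)) - f x - u • g := by
          norm_num
          abel
        rw [e]; exact hA u hu) left_mem_uIcc right_mem_uIcc
  simp only [h.map_zero x hxρ, zero_smul, add_zero, sub_self, sub_zero, Real.norm_eq_abs, ne_eq,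
    OfNat.ofNat_ne_zero, not_false_eq_true, zero_pow, zero_div] at this
  rw [norm_pow, Real.norm_eq_abs]
  exact this.trans_eq (by ring)

/-! ### Second order paths in a set and their transport by flows -/

/-- There is a path `t ↦ z + t • a + t ^ 2 • b + o(t ^ 2)`, `t > 0`, in `S`. -/
def HasPath (S : Set E) (z a b : E) : Prop :=
  ∃ q : ℝ → E, (∀ᶠ t in 𝓝[>] 0, q t ∈ S) ∧
    (fun t => q t - (z + t • a + t ^ 2 • b)) =o[𝓝[>] 0] fun t : ℝ => t ^ 2

lemma hasPath_zero {S : Set E} {z : E} (hz : z ∈ S) : HasPath S z 0 0 :=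
  ⟨fun _ => z, .of_forall fun _ => hz, by simp⟩

lemma HasPath.isTangentDirection {S : Set E} {z a b : E} (h : HasPath S z a b) :
    IsTangentDirection S z a := by
  obtain ⟨q, hq, ho⟩ := h
  have h1 : (fun t : ℝ => t ^ 2) =o[𝓝[>] 0] fun t : ℝ => t := by
    simpa using (isLittleO_pow_pow (𝕜 := ℝ) one_lt_two).mono
      (nhdsWithin_le_nhds (s := Ioi (0 : ℝ)))
  have h2 : (fun t : ℝ => t ^ 2 • b) =o[𝓝[>] 0] fun t : ℝ => t := by
    refine IsBigO.trans_isLittleO ?_ h1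
    exact IsBigO.of_bound ‖b‖ (.of_forall fun t => by rw [norm_smul, mul_comm])
  intro ε hε
  filter_upwards [hq, ((ho.trans h1).add h2).def hε, self_mem_nhdsWithin] with t htS ht (h0 : 0 < t)
  refine ⟨q t, htS, ?_⟩
  rw [Real.norm_of_nonneg h0.le] at ht
  have e : q t - (z + t • a) = q t - (z + t • a + t ^ 2 • b) + t ^ 2 • b := by abel
  rwa [e]

/-- Without a first order term, the reparametrization `t ↦ √t` makes the second order coefficient an
initial velocity. -/
lemma HasPath.isTangentDirection_of_eq_zero {S : Set E} {z b : E} (h : HasPath S z 0 b) :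
    IsTangentDirection S z b := by
  obtain ⟨q, hq, ho⟩ := h
  have hsqrt : Tendsto Real.sqrt (𝓝[>] 0) (𝓝[>] 0) := by
    refine tendsto_nhdsWithin_iff.2 ⟨?_, ?_⟩
    · exact (Real.continuous_sqrt.tendsto' 0 0 Real.sqrt_zero).mono_left nhdsWithin_le_nhds
    · filter_upwards [self_mem_nhdsWithin] with s hs using Real.sqrt_pos.2 hs
  intro ε hε
  filter_upwards [hsqrt.eventually hq, hsqrt.eventually (ho.def hε), self_mem_nhdsWithin]
    with t htS ht (h0 : 0 < t)
  refine ⟨_, htS, ?_⟩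
  rw [Real.sq_sqrt h0.le, Real.norm_of_nonneg h0.le, smul_zero, add_zero] at ht
  exact ht

/-- `S` is invariant under some local flow of `f` around `z`. -/
def IsLocallyInvariant (S : Set E) (f : E → E) (z : E) : Prop :=
  ∃ ρ Φ, IsLocalFlow f z ρ Φ ∧ ∀ x ∈ S ∩ ball z ρ, ∀ t ∈ Ioo (-ρ) ρ, Φ (x, t) ∈ S

/-- Following the flow of `f` for the time `c * t`, the path `z + t • a + t ^ 2 • b + o(t ^ 2)`
becomes another such path. -/
lemma HasPath.flow {S : Set E} {z a b : E} (h : HasPath S z a b) {f : E → E}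
    (hf : ContDiffAt ℝ 1 f z) (hS : IsLocallyInvariant S f z) (c : ℝ) :
    HasPath S z (a + c • f z)
      (b + c • fderiv ℝ f z a + (c ^ 2 / 2) • fderiv ℝ f z (f z)) := by
  obtain ⟨q, hq, ho⟩ := h
  obtain ⟨ρ, Φ, hΦ, hinv⟩ := hS
  set A := fderiv ℝ f z with hA
  have hid : Tendsto (fun t : ℝ => t) (𝓝[>] 0) (𝓝 0) := tendsto_id.mono_left nhdsWithin_le_nhds
  have h1 : (fun t : ℝ => t ^ 2) =o[𝓝[>] 0] fun t : ℝ => t := by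
    simpa using (isLittleO_pow_pow (𝕜 := ℝ) one_lt_two).mono
      (nhdsWithin_le_nhds (s := Ioi (0 : ℝ)))
  have hsq (v : E) : (fun t : ℝ => t ^ 2 • v) =o[𝓝[>] 0] fun t : ℝ => t :=
    IsBigO.trans_isLittleO
      (IsBigO.of_bound ‖v‖ (.of_forall fun t => by rw [norm_smul, mul_comm])) h1
  have hqa : (fun t => q t - z - t • a) =o[𝓝[>] 0] fun t : ℝ => t := by
    refine ((ho.trans h1).add (hsq b)).congr_left fun t => ?_
    module
  have hqO : (fun t => q t - z) =O[𝓝[>] 0] fun t : ℝ => t := by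
    refine (hqa.isBigO.add (IsBigO.of_bound ‖a‖ (.of_forall fun t => ?_)) :
      (fun t => (q t - z - t • a) + t • a) =O[𝓝[>] 0] fun t : ℝ => t).congr_left fun t => ?_
    · rw [norm_smul, mul_comm]
    · abel
  have hqz : Tendsto q (𝓝[>] 0) (𝓝 z) := by
    have := (hqO.trans_tendsto hid).add_const z
    simpa using this
  -- First order suffices here, because the flow expansion multiplies `f (q t)` by the time `c * t`.
  -- The term `c • A a` in the new second order coefficient comes from this.
  have hqf : (fun t => f (q t) - f z - t • A a) =o[𝓝[>] 0] fun t : ℝ => t := by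
    have hd := (hf.differentiableAt one_ne_zero).hasFDerivAt.isLittleO.comp_tendsto hqz
    refine ((hd.trans_isBigO hqO).add ((A.isBigO_comp _ _).trans_isLittleO hqa)).congr_left
      fun t => ?_
    simp only [Function.comp, map_sub, map_smul]
    abel
  have hpair : Tendsto (fun t : ℝ => (q t, c * t)) (𝓝[>] 0) (𝓝 (z, 0)) :=
    hqz.prodMk_nhds (by simpa using hid.const_mul c)
  refine ⟨fun t => Φ (q t, c * t), ?_, ?_⟩
  · filter_upwards [hq, hpair.eventually (ball_mem_nhds _ hΦ.pos)] with t ht ht'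
    rw [Prod.dist_eq, max_lt_iff, Real.dist_eq, sub_zero] at ht'
    exact hinv _ ⟨ht, ht'.1⟩ _ (abs_lt.1 ht'.2)
  · have hflow := (hΦ.isLittleO hf).comp_tendsto hpair
    have hc2 : (fun t : ℝ => (c * t) ^ 2) =O[𝓝[>] 0] fun t : ℝ => t ^ 2 :=
      IsBigO.of_bound (|c| ^ 2) (.of_forall fun t => by
        simp [mul_pow])
    have hmul : (fun t : ℝ => (c * t) • (f (q t) - f z - t • A a)) =o[𝓝[>] 0]
        fun t : ℝ => t ^ 2 := by
      have hct : (fun t : ℝ => c * t) =O[𝓝[>] 0] fun t : ℝ => t :=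
        IsBigO.of_bound |c| (.of_forall fun t => by simp)
      refine (hct.smul_isLittleO hqf).congr_right fun t => ?_
      rw [smul_eq_mul, pow_two]
    refine (((hflow.trans_isBigO hc2).add ho).add hmul).congr_left fun t => ?_
    simp only [Function.comp]
    module

/-! ### Tangency of multiples, sums and Lie brackets -/

variable {S : Set E} {f g : E → E} {z : E}

lemma IsLocallyInvariant.isTangentDirection_smul (hz : z ∈ S) (hf : ContDiffAt ℝ 1 f z)
    (hfS : IsLocallyInvariant S f z) (c : ℝ) : IsTangentDirection S z (c • f z) := by
  simpa using ((hasPath_zero hz).flow hf hfS c).isTangentDirection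

lemma IsLocallyInvariant.isTangentDirection_add (hz : z ∈ S) (hf : ContDiffAt ℝ 1 f z)
    (hg : ContDiffAt ℝ 1 g z) (hfS : IsLocallyInvariant S f z) (hgS : IsLocallyInvariant S g z)
    (c d : ℝ) : IsTangentDirection S z (c • f z + d • g z) := by
  simpa using (((hasPath_zero hz).flow hf hfS c).flow hg hgS d).isTangentDirection

/-- The commutator of the flows of `f` and `g` is tangent to the Lie bracket of `f` and `g`. -/
lemma IsLocallyInvariant.isTangentDirection_lieBracket (hz : z ∈ S) (hf : ContDiffAt ℝ 1 f z)
    (hg : ContDiffAt ℝ 1 g z) (hfS : IsLocallyInvariant S f z) (hgS : IsLocallyInvariant S g z) :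
    IsTangentDirection S z (VectorField.lieBracket ℝ f g z) := by
  -- Flow along `f`, `g`, `-f`, `-g`. The first order terms cancel, and the second order ones leave
  -- `fderiv ℝ g z (f z) - fderiv ℝ f z (g z)`.
  have h := ((((hasPath_zero hz).flow hf hfS 1).flow hg hgS 1).flow hf hfS (-1)).flow hg hgS (-1)
  refine HasPath.isTangentDirection_of_eq_zero ?_
  convert h using 1
  · module
  · rw [VectorField.lieBracket_eq]
    simp only [map_add, map_smul, map_zero]
    module

end Invariance

/-! ### Vector fields tangent to a closed subset of a manifold -/

section Tangency

open Filter Metric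

variable {m : ℕ} {N : Type*} [TopologicalSpace N] [ChartedSpace (Model m) N]

lemma Chart.mdifferentiable (e : Chart m N) :
    e.1.MDifferentiable 𝓘(ℝ, Model m) 𝓘(ℝ, Model m) :=
  ⟨(contMDiffOn_of_mem_maximalAtlas e.2).mdifferentiableOn (by simp),
    (contMDiffOn_symm_of_mem_maximalAtlas e.2).mdifferentiableOn (by simp)⟩

variable [IsManifold 𝓘(ℝ, Model m) ∞ N]

lemma chartField_add (e : Chart m N) (X Y : SmoothField m N) (z : Model m) :
    chartField e (X + Y) z = chartField e X z + chartField e Y z :=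
  map_add (mfderiv 𝓘(ℝ, Model m) 𝓘(ℝ, Model m) e.1 (e.1.symm z)) _ _

lemma chartField_smul (e : Chart m N) (c : ℝ) (X : SmoothField m N) (z : Model m) :
    chartField e (c • X) z = c • chartField e X z :=
  map_smul (mfderiv 𝓘(ℝ, Model m) 𝓘(ℝ, Model m) e.1 (e.1.symm z)) _ _

lemma mfderiv_symm_chartField (e : Chart m N) (X : SmoothField m N) {z : Model m}
    (hz : z ∈ e.1.target) :
    mfderiv 𝓘(ℝ, Model m) 𝓘(ℝ, Model m) e.1.symm z (chartField e X z) = X (e.1.symm z) := by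
  have h := e.mdifferentiable.symm_comp_deriv (e.1.map_target hz)
  rw [e.1.right_inv hz] at h
  exact DFunLike.congr_fun h (X (e.1.symm z))

/-- The derivatives of the chart and of its inverse are mutually inverse. This lets the naturality
of the Lie bracket under pullback be applied to `chartField`. -/
lemma mpullback_symm_eq_chartField (e : Chart m N) (X : SmoothField m N) {z : Model m}
    (hz : z ∈ e.1.target) :
    VectorField.mpullback 𝓘(ℝ, Model m) 𝓘(ℝ, Model m) e.1.symm X z = chartField e X z := by
  have h1 := e.mdifferentiable.symm_comp_deriv (e.1.map_target hz)
  rw [e.1.right_inv hz] at h1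
  have h2 := e.mdifferentiable.comp_symm_deriv hz
  rw [VectorField.mpullback_apply]
  exact DFunLike.congr_fun (ContinuousLinearMap.inverse_eq h1 h2) (X (e.1.symm z))

/-- The Lie bracket in a chart. -/
lemma chartField_lie (e : Chart m N) (X Y : SmoothField m N) {z : Model m}
    (hz : z ∈ e.1.target) :
    chartField e ⁅X, Y⁆ z = VectorField.lieBracket ℝ (chartField e X) (chartField e Y) z := by
  have hn : minSmoothness ℝ 2 ≤ ∞ := by
    rw [minSmoothness_of_isRCLikeNormedField]
    exact two_le_infty
  have hs : ContMDiffAt 𝓘(ℝ, Model m) 𝓘(ℝ, Model m) ∞ e.1.symm z :=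
    (contMDiffOn_symm_of_mem_maximalAtlas e.2).contMDiffAt (e.1.open_target.mem_nhds hz)
  have := IsManifold.of_le (I := 𝓘(ℝ, Model m)) (M := N) (m := minSmoothness ℝ 2) (n := ∞) hn
  have h := VectorField.mpullback_mlieBracket (I := 𝓘(ℝ, Model m)) (I' := 𝓘(ℝ, Model m))
    (X.mdifferentiableAt (e.1.symm z)) (Y.mdifferentiableAt (e.1.symm z)) hs hn
  have hev (Z : SmoothField m N) :
      VectorField.mpullback 𝓘(ℝ, Model m) 𝓘(ℝ, Model m) e.1.symm Z =ᶠ[𝓝 z] chartField e Z := by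
    filter_upwards [e.1.open_target.mem_nhds hz] with w hw
    exact mpullback_symm_eq_chartField e Z hw
  have hvec (V W : ∀ w : Model m, TangentSpace 𝓘(ℝ, Model m) w) :
      VectorField.mlieBracket 𝓘(ℝ, Model m) V W z = VectorField.lieBracket ℝ V W z := by
    rw [← VectorField.mlieBracketWithin_univ, VectorField.mlieBracketWithin_eq_lieBracketWithin]
    exact congrFun VectorField.lieBracketWithin_univ z
  exact (mpullback_symm_eq_chartField e ⁅X, Y⁆ hz).symm.trans
    (h.trans (((hev X).mlieBracket_vectorField_eq (hev Y)).trans (hvec _ _)))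

/-! ### Integral curves and invariance in charts -/

/-- An integral curve, read in a chart. -/
lemma hasDerivAt_chart_comp (e : Chart m N) (X : SmoothField m N) {γ : ℝ → N} {s : Set ℝ}
    (hγ : IsMIntegralCurveOn (I := 𝓘(ℝ, Model m)) γ X s) {t : ℝ} (hs : s ∈ 𝓝 t)
    (ht : γ t ∈ e.1.source) :
    HasDerivAt (fun t => e.1 (γ t)) (chartField e X (e.1 (γ t))) t := by
  have h1 := (hγ t (mem_of_mem_nhds hs)).hasMFDerivAt hs
  have h2 := ((e.mdifferentiable.mdifferentiableAt ht).hasMFDerivAt.comp t h1).hasFDerivAt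
  refine hasDerivAt_iff_hasFDerivAt.2 (h2.congr_fderiv ?_)
  refine ContinuousLinearMap.ext_ring ?_
  have e1 : chartField e X (e.1 (γ t)) =
      mfderiv 𝓘(ℝ, Model m) 𝓘(ℝ, Model m) e.1 (γ t) (X (γ t)) := by
    rw [chartField, e.1.left_inv ht]
  rw [e1]
  change mfderiv 𝓘(ℝ, Model m) 𝓘(ℝ, Model m) e.1 (γ t) ((1 : ℝ) • X (γ t)) = (1 : ℝ) • _
  rw [one_smul, one_smul]

/-- A curve in a chart domain is an integral curve if it is one in the chart. -/
lemma isMIntegralCurveOn_symm_comp (e : Chart m N) (X : SmoothField m N) {α : ℝ → Model m}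
    {s : Set ℝ} (hα : ∀ t ∈ s, α t ∈ e.1.target ∧ HasDerivAt α (chartField e X (α t)) t) :
    IsMIntegralCurveOn (I := 𝓘(ℝ, Model m)) (fun t => e.1.symm (α t)) X s := by
  intro t ht
  obtain ⟨h1, h2⟩ := hα t ht
  have h3 := (e.mdifferentiable.mdifferentiableAt_symm h1).hasMFDerivAt.comp t
    h2.hasFDerivAt.hasMFDerivAt
  refine HasMFDerivAt.hasMFDerivWithinAt ?_
  have e1 : (1 : ℝ →L[ℝ] ℝ).smulRight (X (e.1.symm (α t))) =
      (mfderiv 𝓘(ℝ, Model m) 𝓘(ℝ, Model m) e.1.symm (α t)).comp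
        (ContinuousLinearMap.toSpanSingleton ℝ (chartField e X (α t))) := by
    refine ContinuousLinearMap.ext_ring ?_
    change (1 : ℝ) • X (e.1.symm (α t)) =
      mfderiv 𝓘(ℝ, Model m) 𝓘(ℝ, Model m) e.1.symm (α t) ((1 : ℝ) • chartField e X (α t))
    rw [one_smul, one_smul, mfderiv_symm_chartField e X h1]
  rw [e1]
  exact h3

/-- The flow invariance of a set, read in a chart. -/
lemma FlowPreserves.isLocallyInvariant {X : SmoothField m N} {B : Set N} (h : FlowPreserves X B)
    (e : Chart m N) {z : Model m} (hz : z ∈ e.1.target) :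
    IsLocallyInvariant (chartImage B e) (chartField e X) z := by
  obtain ⟨ρ, Φ, hΦ⟩ := exists_isLocalFlow
    ((contDiffAt_chartField e X hz).of_le (by exact_mod_cast le_top))
  -- Shrink the flow box so that the orbits stay in the chart target and can be carried back to the
  -- manifold.
  obtain ⟨δ, hδ, H⟩ := Metric.eventually_nhds_iff.1
    (hΦ.tendsto.eventually (e.1.open_target.mem_nhds hz))
  have hpos : 0 < min δ ρ := lt_min hδ hΦ.pos
  have hΦ' := hΦ.mono hpos (min_le_right δ ρ)
  refine ⟨min δ ρ, Φ, hΦ', fun x hx t ht => ?_⟩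
  have hT : ∀ s ∈ Ioo (-min δ ρ) (min δ ρ), Φ (x, s) ∈ e.1.target := by
    intro s hs
    refine H ?_
    rw [Prod.dist_eq, Real.dist_eq, sub_zero]
    exact max_lt (hx.2.trans_le (min_le_left _ _)) ((abs_lt.2 hs).trans_le (min_le_left _ _))
  refine ⟨hT t ht, h (e.1.symm x) hx.1.2 (fun s => e.1.symm (Φ (x, s))) _ _ (neg_lt_zero.2 hpos)
    hpos ?_ (isMIntegralCurveOn_symm_comp e X fun s hs => ⟨hT s hs, hΦ'.hasDerivAt x hx.2 s hs⟩)
    t ht⟩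
  rw [hΦ'.map_zero x hx.2]

/-! ### Equivalence of tangency and flow invariance -/

/-- The lines spanned by the values of `X` are tangent to `B` at the points of `B`. -/
def IsTangentTo (X : SmoothField m N) (B : Set N) : Prop :=
  ∀ (e : Chart m N), ∀ z ∈ chartImage B e, ∀ c : ℝ,
    IsTangentDirection (chartImage B e) z (c • chartField e X z)

lemma FlowPreserves.add {X Y : SmoothField m N} {B : Set N} (hX : FlowPreserves X B)
    (hY : FlowPreserves Y B) : IsTangentTo (X + Y) B := by
  intro e z hz c
  rw [chartField_add, smul_add]
  exact IsLocallyInvariant.isTangentDirection_add hz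
    ((contDiffAt_chartField e X hz.1).of_le (by exact_mod_cast le_top))
    ((contDiffAt_chartField e Y hz.1).of_le (by exact_mod_cast le_top))
    (hX.isLocallyInvariant e hz.1) (hY.isLocallyInvariant e hz.1) c c

lemma FlowPreserves.smul {X : SmoothField m N} {B : Set N} (hX : FlowPreserves X B) (c : ℝ) :
    IsTangentTo (c • X) B := by
  intro e z hz d
  rw [chartField_smul, smul_smul]
  exact IsLocallyInvariant.isTangentDirection_smul hz
    ((contDiffAt_chartField e X hz.1).of_le (by exact_mod_cast le_top))
    (hX.isLocallyInvariant e hz.1) (d * c)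

lemma FlowPreserves.isTangentTo {X : SmoothField m N} {B : Set N} (hX : FlowPreserves X B) :
    IsTangentTo X B := by
  simpa using hX.smul 1

/-- The commutator yields a one-sided direction only; negative multiples of the bracket are obtained
later by rescaling `X`. -/
lemma FlowPreserves.lie {X Y : SmoothField m N} {B : Set N} (hX : FlowPreserves X B)
    (hY : FlowPreserves Y B) (e : Chart m N) {z : Model m} (hz : z ∈ chartImage B e) :
    IsTangentDirection (chartImage B e) z (chartField e ⁅X, Y⁆ z) := by
  rw [chartField_lie e X Y hz.1]
  exact IsLocallyInvariant.isTangentDirection_lieBracket hz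
    ((contDiffAt_chartField e X hz.1).of_le (by exact_mod_cast le_top))
    ((contDiffAt_chartField e Y hz.1).of_le (by exact_mod_cast le_top))
    (hX.isLocallyInvariant e hz.1) (hY.isLocallyInvariant e hz.1)

/-- An integral curve of a field that is tangent to a closed set `B` stays in `B` for a short
time. -/
lemma eventually_mem_of_isTangentDirection_chartField {X : SmoothField m N} {B : Set N}
    (hB : IsClosed B)
    (hX : ∀ (e : Chart m N), ∀ z ∈ chartImage B e,
      IsTangentDirection (chartImage B e) z (chartField e X z))
    {γ : ℝ → N} {s : Set ℝ} (hs : IsOpen s)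
    (hγ : IsMIntegralCurveOn (I := 𝓘(ℝ, Model m)) γ X s) {t : ℝ} (ht : t ∈ s) (htB : γ t ∈ B) :
    ∀ᶠ u in 𝓝[>] t, γ u ∈ B := by
  let e : Chart m N := ⟨chartAt (Model m) (γ t), IsManifold.chart_mem_maximalAtlas (γ t)⟩
  have hte : γ t ∈ e.1.source := mem_chart_source (Model m) (γ t)
  have hz : e.1 (γ t) ∈ e.1.target := e.1.map_source hte
  have hzB : e.1 (γ t) ∈ chartImage B e := ⟨hz, by
    rw [mem_preimage, e.1.left_inv hte]; exact htB⟩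
  obtain ⟨K, V, hV, hK⟩ := ((contDiffAt_chartField e X hz).of_le
    (by exact_mod_cast le_top : (1 : ℕ∞ω) ≤ ∞)).exists_lipschitzOnWith
  obtain ⟨r, hr, hrV⟩ := nhds_basis_closedBall.mem_iff.1
    (inter_mem hV (e.1.open_target.mem_nhds hz))
  -- `chartImage B e` is closed only relative to the chart target; cutting with a closed ball inside
  -- the target makes it closed in the model space.
  have hcl : IsClosed (chartImage B e ∩ closedBall (e.1 (γ t)) r) := by
    have h1 : chartImage B e ∩ closedBall (e.1 (γ t)) r =
        closedBall (e.1 (γ t)) r ∩ e.1.symm ⁻¹' B := by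
      ext w
      constructor
      · rintro ⟨h1, h2⟩
        exact ⟨h2, h1.2⟩
      · rintro ⟨h1, h2⟩
        exact ⟨⟨(hrV h1).2, h2⟩, h1⟩
    rw [h1]
    exact (e.1.continuousOn_symm.mono fun w hw => (hrV hw).2).preimage_isClosed_of_isClosed
      isClosed_closedBall hB
  have hsrc : ∀ᶠ u in 𝓝 t, γ u ∈ e.1.source :=
    ((hγ.continuousOn.continuousAt (hs.mem_nhds ht))).eventually (e.1.open_source.mem_nhds hte)
  have key := eventually_mem_of_isTangentDirection (α := fun u => e.1 (γ u)) (t₀ := t) hr hzB hcl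
    (hK.mono fun w hw => (hrV hw).1) (fun p hp => hX e p hp.1) rfl (by
      filter_upwards [hs.mem_nhds ht, hsrc] with u hu hu'
      exact hasDerivAt_chart_comp e X hγ (hs.mem_nhds hu) hu')
  filter_upwards [key, hsrc.filter_mono nhdsWithin_le_nhds] with u hu hu'
  have := hu.2
  rwa [mem_preimage, e.1.left_inv hu'] at this

/-- Continuous induction on `[0, t]`: the times spent in `B` form a closed set containing `0`, and
from each of them the curve stays in `B` a little longer. -/
lemma mem_of_isTangentDirection_chartField {X : SmoothField m N} {B : Set N} (hB : IsClosed B)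
    (hX : ∀ (e : Chart m N), ∀ z ∈ chartImage B e,
      IsTangentDirection (chartImage B e) z (chartField e X z))
    {γ : ℝ → N} {a b : ℝ} (hγ : IsMIntegralCurveOn (I := 𝓘(ℝ, Model m)) γ X (Ioo a b)) (ha : a < 0)
    (h0 : γ 0 ∈ B) {t : ℝ} (ht : t ∈ Ico 0 b) : γ t ∈ B := by
  have hsub : Icc 0 t ⊆ Ioo a b := fun s hs => ⟨ha.trans_le hs.1, hs.2.trans_lt ht.2⟩
  have hcl : IsClosed (γ ⁻¹' B ∩ Icc 0 t) := by
    rw [inter_comm]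
    exact (hγ.continuousOn.mono hsub).preimage_isClosed_of_isClosed isClosed_Icc hB
  refine hcl.Icc_subset_of_forall_mem_nhdsWithin h0 (fun s hs => ?_) ⟨ht.1, le_rfl⟩
  exact eventually_mem_of_isTangentDirection_chartField hB hX isOpen_Ioo hγ
    (hsub (Ico_subset_Icc_self hs.2)) hs.1

/-- Positive times use the tangency of `X`; negative times use that of `-X`, whose integral curves
are the reversed ones. -/
lemma IsTangentTo.flowPreserves {X : SmoothField m N} {B : Set N} (hB : IsClosed B)
    (hX : IsTangentTo X B) : FlowPreserves X B := by
  rintro x hx γ a b ha hb h0 hγ t ht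
  have hx0 : γ 0 ∈ B := by rwa [h0]
  rcases le_total 0 t with h | h
  · exact mem_of_isTangentDirection_chartField hB
      (fun e z hz => by simpa using hX e z hz 1) hγ ha hx0 ⟨h, ht.2⟩
  · have hγ' : IsMIntegralCurveOn (I := 𝓘(ℝ, Model m)) (γ ∘ (· * (-1)))
        ((-1 : ℝ) • X : SmoothField m N) (Ioo (-b) (-a)) :=
      (hγ.comp_mul (-1)).mono fun s hs => by
        simp only [mem_ofPred_eq, mem_Ioo, mul_neg, mul_one] at hs ⊢
        exact ⟨by linarith [hs.2], by linarith [hs.1]⟩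
    have := mem_of_isTangentDirection_chartField hB
      (fun e z hz => by rw [chartField_smul]; exact hX e z hz (-1)) hγ' (neg_lt_zero.2 hb)
      (by simpa using hx0) (t := -t) ⟨by linarith, by linarith [ht.1]⟩
    simpa using this

/-- The vector fields whose flow preserves a closed set form a Lie algebra. -/
def flowPreservingFields {B : Set N} (hB : IsClosed B) : LieSubalgebra ℝ (SmoothField m N) where
  carrier := {X | FlowPreserves X B}
  add_mem' hX hY := (FlowPreserves.add hX hY).flowPreserves hB
  zero_mem' := by
    refine IsTangentTo.flowPreserves hB fun e z hz c ε hε => ?_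
    have h : chartField e (0 : SmoothField m N) z = 0 :=
      map_zero (mfderiv 𝓘(ℝ, Model m) 𝓘(ℝ, Model m) e.1 (e.1.symm z))
    filter_upwards [self_mem_nhdsWithin] with t (ht : 0 < t)
    refine ⟨z, hz, ?_⟩
    rw [h]
    simpa using (mul_pos hε ht).le
  smul_mem' c _ hX := (FlowPreserves.smul hX c).flowPreserves hB
  lie_mem' {X Y} hX hY := by
    refine IsTangentTo.flowPreserves hB fun e z hz c => ?_
    -- Since `c • ⁅X, Y⁆ = ⁅c • X, Y⁆` and `c • X` also preserves `B`, multiples of either sign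
    -- reduce to the bracket itself.
    have hcX : FlowPreserves (c • X) B := (FlowPreserves.smul hX c).flowPreserves hB
    rw [← chartField_smul, ← smul_lie]
    exact hcX.lie hY e hz

end Tangency

/-! ### Fields tangent to the boundary of a Whitney pair -/

namespace WhitneyPair

variable {m : ℕ} {N : Type*} [TopologicalSpace N] [ChartedSpace (Model m) N]
  [IsManifold 𝓘(ℝ, Model m) ∞ N] (M : WhitneyPair m N)

lemma isClosed_boundary : IsClosed M.boundary := isClosed_frontier

lemma chartImage_boundary_subset (e : Chart m N) :
    chartImage M.boundary e ⊆ chartImage M.carrier e :=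
  inter_subset_inter_right _ (preimage_mono M.isClosed.frontier_subset)

/-- The value at a point of `M` of a vector field on `M`, in a chart. -/
def evalChart (e : Chart m N) {z : Model m} (hz : z ∈ chartImage M.carrier e) :
    M.fields →ₗ[ℝ] Model m :=
  (mfderiv 𝓘(ℝ, Model m) 𝓘(ℝ, Model m) e.1 (e.1.symm z)).toLinearMap ∘ₗ
    LinearMap.proj (⟨e.1.symm z, hz.2⟩ : M.carrier) ∘ₗ M.fields.subtype

lemma evalChart_restrict (e : Chart m N) {z : Model m} (hz : z ∈ chartImage M.carrier e)
    (X : SmoothField m N) : M.evalChart e hz (M.restrict X) = chartField e X z := rfl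

/-- Evaluation is controlled by a single Whitney seminorm: order `0` on the compact set `{z}`. -/
lemma continuous_evalChart (e : Chart m N) {z : Model m} (hz : z ∈ chartImage M.carrier e) :
    Continuous[M.fieldTopology, inferInstance] (M.evalChart e hz) := by
  let A : Set (Set (Model m)) := {K | K ⊆ chartImage M.carrier e ∧ IsCompact K}
  let ev : (Model m → FormalMultilinearSeries ℝ (Model m) (Model m)) → Model m :=
    fun p => p z 0 ![]
  have h1 : Continuous[whitneyTopology (chartImage M.carrier e), inferInstance] ev := by
    have hA : {z} ∈ A := ⟨singleton_subset_iff.2 hz, isCompact_singleton⟩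
    have h2 : Continuous fun g : UniformOnFun (Model m) (Model m [×0]→L[ℝ] Model m) A =>
        UniformOnFun.toFun A g z ![] := by
      have h3 := (UniformOnFun.uniformContinuous_eval_of_mem (Model m [×0]→L[ℝ] Model m) A
        (mem_singleton z) hA).continuous
      exact (ContinuousMultilinearMap.apply ℝ (fun _ : Fin 0 => Model m) (Model m)
        ![]).continuous.comp h3
    refine continuous_le_dom (inf_le_left.trans (iInf_le _ 0)) ?_
    exact @Continuous.comp _ _ _ (_) (_) (_)
      (fun p : Model m → FormalMultilinearSeries ℝ (Model m) (Model m) =>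
        UniformOnFun.ofFun A fun w => p w 0) _ h2 continuous_induced_dom
  have h4 : ⇑(M.evalChart e hz) = fun X : M.fields => ev (chartFieldSeries e (extend X)) := by
    funext X
    change _ = iteratedFDeriv ℝ 0 (chartField e (extend X)) z ![]
    rw [iteratedFDeriv_zero_apply, ← M.evalChart_restrict e hz, restrict_extend]
  rw [h4]
  refine continuous_le_dom (iInf_le _ e) ?_
  exact @Continuous.comp _ _ _ (_) (_) (_) (fun X : M.fields => chartFieldSeries e (extend X)) ev h1
    continuous_induced_dom

lemma continuous_evalChart_compact (e : Chart m N) {z : Model m}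
    (hz : z ∈ chartImage M.carrier e) :
    Continuous[M.compactFieldTopology, inferInstance]
      (fun X : M.compactFields => M.evalChart e hz X.1) := by
  let φ : M.compactFields →ₗ[ℝ] Model m := M.evalChart e hz ∘ₗ M.compactFields.toSubmodule.subtype
  -- The topology induced by the linear map `φ` is one of the locally convex topologies in the
  -- family defining the LF topology, so the LF topology is finer and `φ` is continuous for it.
  refine continuous_le_dom (t₁ := TopologicalSpace.induced φ inferInstance) (sInf_le ?_)
    continuous_induced_dom
  refine ⟨topologicalAddGroup_induced φ, continuousSMul_induced φ, LocallyConvexSpace.induced φ,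
    fun K _ _ => ?_⟩
  refine continuous_induced_rng.2 ?_
  exact @Continuous.comp _ _ _ (_) (_) (_)
    (fun X : {X : M.compactFields // M.supp X.1 ⊆ K} => X.1.1) (M.evalChart e hz)
    (M.continuous_evalChart e hz) continuous_induced_dom

/-- The pointwise description of `𝔛_∂(M)`. -/
lemma mem_boundaryFields_iff (Y : M.fields) :
    Y ∈ M.boundaryFields ↔ ∀ (e : Chart m N) (z : Model m) (hz : z ∈ chartImage M.boundary e)
      (c : ℝ), IsTangentDirection (chartImage M.boundary e) z
        (c • M.evalChart e (M.chartImage_boundary_subset e hz) Y) := by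
  constructor
  · rintro ⟨X, rfl, hX⟩ e z hz c
    rw [evalChart_restrict]
    exact hX.isTangentTo e z hz c
  · intro h
    -- Any extension would serve: tangency only sees values on `∂M`, and these are determined by
    -- `Y`.
    refine ⟨extend Y, restrict_extend Y, IsTangentTo.flowPreserves M.isClosed_boundary ?_⟩
    intro e z hz c
    have := h e z hz c
    rwa [← restrict_extend Y, evalChart_restrict] at this

/-- `𝔛_∂(M)` as a Lie subalgebra of `𝔛(M)`. -/
def boundaryLieSubalgebra : LieSubalgebra ℝ M.fields where
  __ := (flowPreservingFields M.isClosed_boundary).toSubmodule.map M.restrict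
  lie_mem' := by
    rintro _ _ ⟨X, hX, rfl⟩ ⟨Y, hY, rfl⟩
    exact ⟨⁅X, Y⁆, (flowPreservingFields M.isClosed_boundary).lie_mem hX hY, M.restrict_lie X Y⟩

lemma coe_boundaryLieSubalgebra : (M.boundaryLieSubalgebra : Set M.fields) = M.boundaryFields := by
  ext Y
  exact exists_congr fun X => and_comm

lemma boundaryFields_eq_iInter :
    M.boundaryFields = ⋂ (e : Chart m N) (z : Model m) (hz : z ∈ chartImage M.boundary e) (c : ℝ),
      (fun Y => c • M.evalChart e (M.chartImage_boundary_subset e hz) Y) ⁻¹'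
        {v | IsTangentDirection (chartImage M.boundary e) z v} := by
  ext Y
  rw [mem_boundaryFields_iff]
  simp only [mem_iInter]
  rfl

lemma isClosed_boundaryFields : IsClosed[M.fieldTopology] M.boundaryFields := by
  let := M.fieldTopology
  rw [boundaryFields_eq_iInter]
  refine isClosed_iInter fun e => isClosed_iInter fun z => isClosed_iInter fun hz =>
    isClosed_iInter fun c => ?_
  exact (isClosed_setOf_isTangentDirection _ z).preimage
    ((M.continuous_evalChart e (M.chartImage_boundary_subset e hz)).const_smul c)

lemma isClosed_compactBoundaryFields :
    IsClosed[M.compactFieldTopology] M.compactBoundaryFields := by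
  let := M.compactFieldTopology
  change IsClosed (Subtype.val ⁻¹' M.boundaryFields)
  simp only [boundaryFields_eq_iInter, preimage_iInter]
  refine isClosed_iInter fun e => isClosed_iInter fun z => isClosed_iInter fun hz =>
    isClosed_iInter fun c => ?_
  exact (isClosed_setOf_isTangentDirection _ z).preimage
    ((M.continuous_evalChart_compact e (M.chartImage_boundary_subset e hz)).const_smul c)

end WhitneyPair

end WhitneyGerm

end

open scoped Manifold ContDiff Topology

theorem mainTheorem12 (m : ℕ) (N : Type*) [TopologicalSpace N] [T2Space N]
    [SecondCountableTopology N] [ConnectedSpace N]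
    [ChartedSpace (WhitneyGerm.Model m) N]
    [IsManifold 𝓘(ℝ, WhitneyGerm.Model m) ∞ N]
    (M : WhitneyGerm.WhitneyPair m N) :
    (∃ L : LieSubalgebra ℝ M.fields,
      (L : Set M.fields) = M.boundaryFields ∧
      IsClosed[M.fieldTopology] (L : Set M.fields)) ∧
    (∃ L : LieSubalgebra ℝ M.compactFields,
      (L : Set M.compactFields) = M.compactBoundaryFields ∧
      IsClosed[M.compactFieldTopology] (L : Set M.compactFields)) := by
  have h : ((M.boundaryLieSubalgebra.comap M.compactFields.incl : LieSubalgebra ℝ M.compactFields) :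
      Set M.compactFields) = M.compactBoundaryFields := by
    ext Y
    change (Y : M.fields) ∈ (M.boundaryLieSubalgebra : Set M.fields) ↔ _
    rw [M.coe_boundaryLieSubalgebra]
    rfl
  exact ⟨⟨M.boundaryLieSubalgebra, M.coe_boundaryLieSubalgebra,
      M.coe_boundaryLieSubalgebra ▸ M.isClosed_boundaryFields⟩,
    ⟨M.boundaryLieSubalgebra.comap M.compactFields.incl, h,
      h ▸ M.isClosed_compactBoundaryFields⟩⟩
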